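/- Let $\lambda\ge 0$, $p,q\ge 0$ with $p+q=1$, $\lambda_1>1$, $\lambda_2>0$. Assume zero interest and dividend rates, and that under the risk-neutral probability measure $\mathbb{P}$, with filtration $(\mathcal F_t)_{t\ge0}$, the underlying $S=(S_t)_{t\ge 0}$ follows a double exponential (Kou) model: $S$ is a positive $(\mathcal F_t)$-martingale whose logarithm is a pure-jump Lévy process relative to $(\mathcal F_t)$ (no Gaussian component; a deterministic linear drift is allowed, the initial value may be $\mathcal F_0$-measurable) with Lévy density $$\eta(x)=\lambda\left(p\lambda_1e^{-\lambda_1x}\mathbf 1_{x\ge0}+q\lambda_2e^{\lambda_2x}\mathbf 1_{x<0}\right).$$ Let $K>0$ and $0\le t\le T$. Then $(S_T-K)^+$ is integrable, and the time-$t$ price $\mathbb{E}[(S_T-K)^+\mid\mathcal F_t]$ of the European call option with strike $K$ and maturity $T$ is almost surely equal to $$S_t\,\Psi\left(-\lambda\zeta,\lambda^*,p^*,\lambda_1^*,\lambda_2^*;\log(K/S_t),T-t\right)-K\,\Psi\left(-\lambda\zeta,\lambda,p,\lambda_1,\lambda_2;\log(K/S_t),T-t\right),$$ where $$\zeta=\frac{p\lambda_1}{\lambda_1-1}+\frac{q\lambda_2}{\lambda_2+1}-1,\quad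 \lambda^*=\lambda(\zeta+1),\quad p^*=\frac{p}{1+\zeta}\cdot\frac{\lambda_1}{\lambda_1-1},\quad \lambda_1^*=\lambda_1-1,\quad\lambda_2^*=\lambda_2+1.$$ The function $\Psi$ is given, with $b=a-\mu\tau$, by $$\begin{aligned}\Psi(\mu,\lambda,p,\lambda_1,\lambda_2;a,\tau)={}&\pi_0\mathbf 1_{b\le0}+\sum_{n=1}^\infty\pi_n\sum_{k=1}^nP_{n,k}\left[\sum_{i=0}^{k-1}\frac{(\lambda_1b)^i}{i!}e^{-\lambda_1b}\mathbf 1_{b\ge0}+\mathbf 1_{b<0}\right]\\&+\sum_{n=1}^\infty\pi_n\sum_{k=1}^nQ_{n,k}\left(1-\sum_{i=0}^{k-1}\frac{(-\lambda_2b)^i}{i!}e^{\lambda_2b}\right)\mathbf 1_{b<0},\end{aligned}$$ with $0^0=1$, $\pi_n=e^{-\lambda\tau}(\lambda\tau)^n/n!$, and, with $q=1-p$ for the parameter $p$ passed to $\Psi$ (so $q=1-p^*$ in the first term of the price), for $1\le k\le n-1$, $$P_{n,k}=\sum_{i=k}^{n-1}\binom{n-k-1}{i-k}\binom ni\left(\frac{\lambda_1}{\lambda_1+\lambda_2}\right)^{i-k}\left(\frac{\lambda_2}{\lambda_1+\lambda_2}\right)^{n-i}p^iq^{n-i},$$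 $$Q_{n,k}=\sum_{i=k}^{n-1}\binom{n-k-1}{i-k}\binom ni\left(\frac{\lambda_1}{\lambda_1+\lambda_2}\right)^{n-i}\left(\frac{\lambda_2}{\lambda_1+\lambda_2}\right)^{i-k}p^{n-i}q^i,$$ and $P_{n,n}=p^n$, $Q_{n,n}=q^n$. For both parameter sets in the price, with $\tau=T-t$, both infinite series in $\Psi$ converge for every $a\in\mathbb R$. -/

import Mathlib

open MeasureTheory ProbabilityTheory Filter Topology
open scoped NNReal ENNReal

noncomputable section

/-! ### Lévy processes with a given characteristic triplet -/

/-- `X` is a Lévy process relative to the filtration `ℱ` under `P`, started from an arbitrary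
(possibly random) initial value `X 0`: it is adapted, its increments after time `s` are independent
of `ℱ s` and stationary, and almost every path is right-continuous with left limits. -/
structure IsLevyProcess {Ω : Type*} {m : MeasurableSpace Ω} (X : ℝ≥0 → Ω → ℝ)
    (ℱ : Filtration ℝ≥0 m) (P : Measure Ω) : Prop where
  adapted : Adapted ℱ X
  indep_increments : ∀ s t : ℝ≥0, s ≤ t →
    Indep (MeasurableSpace.comap (fun ω => X t ω - X s ω) inferInstance) (ℱ s) P
  stationary_increments : ∀ s h : ℝ≥0,
    IdentDistrib (fun ω => X (s + h) ω - X s ω) (fun ω => X h ω - X 0 ω) P P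
  cadlag : ∀ᵐ ω ∂P, ∀ t : ℝ≥0,
    ContinuousWithinAt (fun u => X u ω) (Set.Ici t) t ∧
      ∃ l : ℝ, Tendsto (fun u => X u ω) (𝓝[<] t) (𝓝 l)

/-- `ν` is a Lévy measure on `ℝ`: no mass at `0` and `∫ min(1, x²) ν(dx) < ∞`. -/
def IsLevyMeasure (ν : Measure ℝ) : Prop :=
  ν {0} = 0 ∧ ∫⁻ x, ENNReal.ofReal (min 1 (x ^ 2)) ∂ν < ∞

/-- The Lévy–Khintchine exponent of the characteristic triplet `(γ, σ2, ν)` at `u`: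
`i γ u - σ2 u² / 2 + ∫ (e^{iux} - 1 - i u x 1_{|x| ≤ 1}) ν(dx)`. -/
def levyExponent (γ σ2 : ℝ) (ν : Measure ℝ) (u : ℝ) : ℂ :=
  Complex.I * γ * u - σ2 * u ^ 2 / 2 +
    ∫ x : ℝ, (Complex.exp (Complex.I * u * x) - 1 -
      if |x| ≤ 1 then Complex.I * u * x else 0) ∂ν

/-- The Lévy process `X` has characteristic triplet `(γ, σ2, ν)`: the characteristic function of
`X t - X 0` is `exp (t · levyExponent)`. -/
def HasLevyTriplet {Ω : Type*} {m : MeasurableSpace Ω} (X : ℝ≥0 → Ω → ℝ) (P : Measure Ω)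
    (γ σ2 : ℝ) (ν : Measure ℝ) : Prop :=
  IsLevyMeasure ν ∧ 0 ≤ σ2 ∧
    ∀ (t : ℝ≥0) (u : ℝ), charFun (P.map (fun ω => X t ω - X 0 ω)) u =
      Complex.exp (((t : ℝ) : ℂ) * levyExponent γ σ2 ν u)

/-- `X` is a pure-jump Lévy process (no Gaussian component; a deterministic linear drift is
allowed) with Lévy density `η`. -/
def IsPureJumpLevyWithDensity {Ω : Type*} {m : MeasurableSpace Ω} (X : ℝ≥0 → Ω → ℝ)
    (ℱ : Filtration ℝ≥0 m) (P : Measure Ω) (η : ℝ → ℝ) : Prop :=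
  IsLevyProcess X ℱ P ∧
    ∃ γ : ℝ, HasLevyTriplet X P γ 0 (volume.withDensity fun x => ENNReal.ofReal (η x))

/-! ### The double exponential (Kou) model -/

/-- The double exponential Lévy density
`η(x) = lam (p l₁ e^{-l₁ x} 1_{x ≥ 0} + q l₂ e^{l₂ x} 1_{x < 0})`. -/
def kouDensity (lam p q l₁ l₂ : ℝ) (x : ℝ) : ℝ :=
  lam * (if 0 ≤ x then p * l₁ * Real.exp (-l₁ * x) else q * l₂ * Real.exp (l₂ * x))

/-- `S` follows a double exponential model under the risk-neutral measure `P`, with zero interest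
and dividend rates: it is a positive martingale whose logarithm is a pure-jump Lévy process with
double exponential Lévy density. The drift is not prescribed; it is forced by the martingale
property. -/
structure IsKouModel {Ω : Type*} {m : MeasurableSpace Ω} (S : ℝ≥0 → Ω → ℝ)
    (ℱ : Filtration ℝ≥0 m) (P : Measure Ω) (lam p q l₁ l₂ : ℝ) : Prop where
  pos : ∀ t ω, 0 < S t ω
  martingale : Martingale S ℱ P
  log_levy : IsPureJumpLevyWithDensity (fun t ω => Real.log (S t ω)) ℱ P
    (kouDensity lam p q l₁ l₂)

/-- The time-`t` price of the European call with strike `K` and maturity `T`, at zero interest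
rate: the risk-neutral conditional expectation of the payoff `(S_T - K)⁺`. -/
def callPrice {Ω : Type*} {m : MeasurableSpace Ω} (S : ℝ≥0 → Ω → ℝ)
    (ℱ : Filtration ℝ≥0 m) (P : Measure Ω) (K : ℝ) (T t : ℝ≥0) : Ω → ℝ :=
  P[fun ω => max (S T ω - K) 0 | ℱ t]

/-! ### The function `Ψ` -/

/-- The coefficient `P_{n,k}`, `1 ≤ k ≤ n`, with `q = 1 - p`. -/
def kouP (p l₁ l₂ : ℝ) (n k : ℕ) : ℝ :=
  if k = n then p ^ n
  else ∑ i ∈ Finset.Icc k (n - 1), ((n - k - 1).choose (i - k) : ℝ) * (n.choose i : ℝ) *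
    (l₁ / (l₁ + l₂)) ^ (i - k) * (l₂ / (l₁ + l₂)) ^ (n - i) * p ^ i * (1 - p) ^ (n - i)

/-- The coefficient `Q_{n,k}`, `1 ≤ k ≤ n`, with `q = 1 - p`. -/
def kouQ (p l₁ l₂ : ℝ) (n k : ℕ) : ℝ :=
  if k = n then (1 - p) ^ n
  else ∑ i ∈ Finset.Icc k (n - 1), ((n - k - 1).choose (i - k) : ℝ) * (n.choose i : ℝ) *
    (l₁ / (l₁ + l₂)) ^ (n - i) * (l₂ / (l₁ + l₂)) ^ (i - k) * p ^ (n - i) * (1 - p) ^ i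

/-- The Poisson weight `π_n = e^{-lam T} (lam T)^n / n!`. -/
def kouWeight (lam T : ℝ) (n : ℕ) : ℝ :=
  Real.exp (-(lam * T)) * (lam * T) ^ n / (n.factorial : ℝ)

/-- The `n`-th term (`n ≥ 1`) of the first series in `Ψ`; here `b = a - μ T`. -/
def kouPosTerm (lam p l₁ l₂ b T : ℝ) (n : ℕ) : ℝ :=
  kouWeight lam T n * ∑ k ∈ Finset.Icc 1 n, kouP p l₁ l₂ n k *
    ((∑ i ∈ Finset.range k, (l₁ * b) ^ i / (i.factorial : ℝ) * Real.exp (-(l₁ * b))) *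
        (if 0 ≤ b then 1 else 0) + (if b < 0 then 1 else 0))

/-- The `n`-th term (`n ≥ 1`) of the second series in `Ψ`; here `b = a - μ T`. -/
def kouNegTerm (lam p l₁ l₂ b T : ℝ) (n : ℕ) : ℝ :=
  kouWeight lam T n * ∑ k ∈ Finset.Icc 1 n, kouQ p l₁ l₂ n k *
    (1 - ∑ i ∈ Finset.range k, (-(l₂ * b)) ^ i / (i.factorial : ℝ) * Real.exp (l₂ * b)) *
      (if b < 0 then 1 else 0)

/-- `Ψ(μ, lam, p, l₁, l₂; a, T)`. The series over `n ≥ 1` are indexed by `n + 1`, `n ≥ 0`. -/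
def kouPsi (μ lam p l₁ l₂ a T : ℝ) : ℝ :=
  kouWeight lam T 0 * (if a - μ * T ≤ 0 then 1 else 0) +
    ∑' n : ℕ, kouPosTerm lam p l₁ l₂ (a - μ * T) T (n + 1) +
    ∑' n : ℕ, kouNegTerm lam p l₁ l₂ (a - μ * T) T (n + 1)

/-- The two series in `Ψ(μ, lam, p, l₁, l₂; a, T)` converge. -/
def KouPsiConverges (μ lam p l₁ l₂ a T : ℝ) : Prop :=
  (Summable fun n : ℕ => kouPosTerm lam p l₁ l₂ (a - μ * T) T (n + 1)) ∧
    Summable fun n : ℕ => kouNegTerm lam p l₁ l₂ (a - μ * T) T (n + 1)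

/-- `ζ = p l₁ / (l₁ - 1) + q l₂ / (l₂ + 1) - 1`. -/
def kouZeta (p q l₁ l₂ : ℝ) : ℝ := p * l₁ / (l₁ - 1) + q * l₂ / (l₂ + 1) - 1

/-- `p* = p / (1 + ζ) · l₁ / (l₁ - 1)`. -/
def kouPStar (p q l₁ l₂ : ℝ) : ℝ := p / (1 + kouZeta p q l₁ l₂) * (l₁ / (l₁ - 1))

/-- `lam* = lam (ζ + 1)`. -/
def kouLamStar (lam p q l₁ l₂ : ℝ) : ℝ := lam * (kouZeta p q l₁ l₂ + 1)

end

/-!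
Let `φ z = p l₁ / (l₁ - z) + (1 - p) l₂ / (l₂ + z)` be the moment generating function of one jump.
The `P_{n,k}` and `Q_{n,k}` are the coefficients of the partial fraction expansion of `φ ^ n`, so
that the sum of `n` jumps is a mixture of Erlang laws on the two half-lines, and `Ψ` is the tail
of a drift plus a compound Poisson variable with moment generating function
`z ↦ exp (lam T (φ z - 1))` on the strip `-l₂ < Re z < l₁`. On the imaginary axis this identifies
the increments of the log-price through the Lévy–Khintchine formula; at `z = 1` the martingale
property forces the drift to be `-lam ζ`; and on the line `Re z = 1` it shows that the exponential
tilt of the law by `e^x` belongs to the same family, with the starred parameters; this gives the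
first term of the price.
-/

/-! ### Erlang laws -/

lemma hasDerivAt_sum_pow_div_factorial {𝕜 : Type*} [NontriviallyNormedField 𝕜] [CharZero 𝕜]
    (j : ℕ) (z : 𝕜) :
    HasDerivAt (fun z => ∑ i ∈ Finset.range (j + 1), z ^ i / (i.factorial : 𝕜))
      (∑ i ∈ Finset.range j, z ^ i / (i.factorial : 𝕜)) z := by
  induction j with
  | zero => simpa using hasDerivAt_const z (1 : 𝕜)
  | succ j ih =>
    have hlast : HasDerivAt (fun z : 𝕜 => z ^ (j + 1) / ((j + 1).factorial : 𝕜))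
        (z ^ j / (j.factorial : 𝕜)) z := by
      refine ((hasDerivAt_pow (j + 1) z).div_const _).congr_deriv ?_
      rw [Nat.factorial_succ, Nat.add_sub_cancel, Nat.cast_mul,
        mul_div_mul_left _ _ (Nat.cast_ne_zero.mpr j.succ_ne_zero)]
    simp_rw [Finset.sum_range_succ _ (j + 1)]
    rw [Finset.sum_range_succ]
    exact ih.add hlast

lemma hasDerivAt_exp_neg_mul_sum_pow_div_factorial (j : ℕ) (z : ℂ) :
    HasDerivAt
      (fun z => -(Complex.exp (-z) * ∑ i ∈ Finset.range (j + 1), z ^ i / (i.factorial : ℂ)))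
      (z ^ j / (j.factorial : ℂ) * Complex.exp (-z)) z := by
  refine (((hasDerivAt_neg z).cexp.mul (hasDerivAt_sum_pow_div_factorial j z)).neg).congr_deriv ?_
  rw [Finset.sum_range_succ]
  ring

lemma tendsto_pow_mul_exp_neg_mul_atTop (j : ℕ) {r : ℂ} (hr : 0 < r.re) :
    Tendsto (fun x : ℝ => (r * x) ^ j * Complex.exp (-(r * x))) atTop (𝓝 0) := by
  rw [tendsto_zero_iff_norm_tendsto_zero]
  have h := (tendsto_rpow_mul_exp_neg_mul_atTop_nhds_zero j r.re hr).const_mul (‖r‖ ^ j)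
  rw [mul_zero] at h
  refine h.congr' ?_
  filter_upwards [eventually_ge_atTop 0] with x hx
  simp only [norm_mul, norm_pow, Complex.norm_exp, Complex.norm_real, Real.norm_of_nonneg hx,
    Real.rpow_natCast, Complex.neg_re, Complex.re_mul_ofReal, neg_mul]
  ring

lemma integrableOn_pow_mul_exp_neg_mul_Ioi (j : ℕ) {r : ℂ} (hr : 0 < r.re) :
    IntegrableOn (fun x : ℝ => (x : ℂ) ^ j * Complex.exp (-(r * x))) (Set.Ioi 0) := by
  have h := integrableOn_rpow_mul_exp_neg_mul_rpow (p := 1) (s := j) (b := r.re)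
    (by linarith [(j.cast_nonneg : (0 : ℝ) ≤ j)]) one_pos hr
  refine Integrable.mono h (Continuous.aestronglyMeasurable (by fun_prop))
    (ae_of_all _ fun x => le_of_eq ?_)
  simp [Complex.norm_exp]

lemma integral_pow_mul_exp_neg_mul_Ioi (j : ℕ) {r : ℂ} (hr : 0 < r.re) {b : ℝ} (hb : 0 ≤ b) :
    ∫ x in Set.Ioi b, r ^ (j + 1) / (j.factorial : ℂ) * (x : ℂ) ^ j * Complex.exp (-(r * x)) =
      Complex.exp (-(r * b)) * ∑ i ∈ Finset.range (j + 1), (r * b) ^ i / (i.factorial : ℂ) := by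
  have hderiv : ∀ x ∈ Set.Ici b, HasDerivAt
      (fun x : ℝ => -(Complex.exp (-(r * x)) *
        ∑ i ∈ Finset.range (j + 1), (r * x) ^ i / (i.factorial : ℂ)))
      (r ^ (j + 1) / (j.factorial : ℂ) * (x : ℂ) ^ j * Complex.exp (-(r * x))) x := fun x _ =>
    ((hasDerivAt_exp_neg_mul_sum_pow_div_factorial j (r * x)).comp (x : ℂ)
      (hasDerivAt_const_mul r)).comp_ofReal.congr_deriv (by ring)
  have hlim : Tendsto (fun x : ℝ => -(Complex.exp (-(r * x)) *
      ∑ i ∈ Finset.range (j + 1), (r * x) ^ i / (i.factorial : ℂ))) atTop (𝓝 0) := by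
    have h := (tendsto_finsetSum (Finset.range (j + 1)) fun i _ =>
      (tendsto_pow_mul_exp_neg_mul_atTop i hr).div_const (i.factorial : ℂ)).neg
    simp only [zero_div, Finset.sum_const_zero, neg_zero] at h
    refine h.congr fun x => ?_
    rw [Finset.mul_sum]
    exact congrArg _ (Finset.sum_congr rfl fun i _ => by ring)
  have hint : IntegrableOn (fun x : ℝ =>
      r ^ (j + 1) / (j.factorial : ℂ) * (x : ℂ) ^ j * Complex.exp (-(r * x))) (Set.Ioi b) := by
    simpa only [IntegrableOn, mul_assoc] using ((integrableOn_pow_mul_exp_neg_mul_Ioi j hr).mono_set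
      (Set.Ioi_subset_Ioi hb)).const_mul (r ^ (j + 1) / (j.factorial : ℂ))
  rw [integral_Ioi_of_hasDerivAt_of_tendsto' hderiv hint hlim, zero_sub, neg_neg]

lemma measurable_gammaPDF (a r : ℝ) : Measurable (gammaPDF a r) :=
  (measurable_gammaPDFReal a r).ennreal_ofReal

lemma gammaPDFReal_natCast_succ (j : ℕ) (l : ℝ) {x : ℝ} (hx : 0 ≤ x) :
    gammaPDFReal ((j + 1 : ℕ) : ℝ) l x =
      l ^ (j + 1) / (j.factorial : ℝ) * x ^ j * Real.exp (-(l * x)) := by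
  rw [gammaPDFReal, if_pos hx, Nat.cast_succ, add_sub_cancel_right, Real.rpow_natCast,
    ← Nat.cast_succ, Real.rpow_natCast, Nat.cast_succ, Real.Gamma_nat_eq_factorial]

lemma gammaMeasure_Iio_of_nonpos (a r : ℝ) {b : ℝ} (hb : b ≤ 0) :
    gammaMeasure a r (Set.Iio b) = 0 := by
  rw [gammaMeasure, withDensity_apply _ measurableSet_Iio, lintegral_gammaPDF_of_nonpos hb]

lemma gammaMeasure_map_neg (a r : ℝ) :
    (gammaMeasure a r).map Neg.neg = volume.withDensity fun x => gammaPDF a r (-x) := by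
  ext s hs
  rw [Measure.map_apply measurable_neg hs, gammaMeasure, withDensity_apply _ (measurable_neg hs),
    withDensity_apply _ hs,
    ← (Measure.measurePreserving_neg (volume : Measure ℝ)).setLIntegral_comp_preimage hs
      (f := fun x => gammaPDF a r (-x))
      ((measurable_gammaPDF a r).comp measurable_neg)]
  simp only [neg_neg]

lemma setIntegral_Ici_exp_mul_gammaMeasure (j : ℕ) {l : ℝ} (hl : 0 < l) {z : ℂ}
    (hz : z.re < l) {b : ℝ} (hb : 0 ≤ b) :
    ∫ x in Set.Ici b, Complex.exp (z * x) ∂gammaMeasure ((j + 1 : ℕ) : ℝ) l =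
      (l / (l - z)) ^ (j + 1) * (Complex.exp (-((l - z) * b)) *
        ∑ i ∈ Finset.range (j + 1), ((l - z) * b) ^ i / (i.factorial : ℂ)) := by
  have hre : 0 < ((l : ℂ) - z).re := by simpa using hz
  have hne : (l : ℂ) - z ≠ 0 := fun h => by simp [h] at hre
  have hpos : (0 : ℝ) < ((j + 1 : ℕ) : ℝ) := by positivity
  rw [← integral_pow_mul_exp_neg_mul_Ioi j hre hb, gammaMeasure,
    setIntegral_withDensity_eq_setIntegral_toReal_smul
      (measurable_gammaPDF _ l) (ae_of_all _ fun _ => ENNReal.ofReal_lt_top) _ measurableSet_Ici,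
    integral_Ici_eq_integral_Ioi, ← integral_const_mul]
  refine setIntegral_congr_fun measurableSet_Ioi fun x (hx : b < x) => ?_
  have hexp : Complex.exp (-((l - z) * x)) = Complex.exp (-(l * x)) * Complex.exp (z * x) := by
    rw [← Complex.exp_add]
    ring_nf
  simp only [gammaPDF]
  rw [ENNReal.toReal_ofReal (gammaPDFReal_nonneg hpos hl x),
    gammaPDFReal_natCast_succ j l (hb.trans hx.le), Complex.real_smul, hexp, div_pow]
  push_cast
  field_simp

lemma complexMGF_gammaMeasure {k : ℕ} (hk : 0 < k) {l : ℝ} (hl : 0 < l) {z : ℂ}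
    (hz : z.re < l) : complexMGF id (gammaMeasure k l) z = (l / (l - z)) ^ k := by
  obtain ⟨j, rfl⟩ := Nat.exists_eq_add_one_of_ne_zero hk.ne'
  have hsupp : ∀ᵐ x ∂gammaMeasure ((j + 1 : ℕ) : ℝ) l, x ∈ Set.Ici (0 : ℝ) := by
    rw [ae_iff]
    simpa [Set.Iio] using gammaMeasure_Iio_of_nonpos _ l le_rfl
  rw [complexMGF, ← Measure.restrict_eq_self_of_ae_mem hsupp]
  refine (setIntegral_Ici_exp_mul_gammaMeasure j hl hz le_rfl).trans ?_
  rw [Finset.sum_range_succ']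
  simp

lemma gammaMeasure_real_Ici_of_nonpos {a r : ℝ} (ha : 0 < a) (hr : 0 < r) {b : ℝ} (hb : b ≤ 0) :
    (gammaMeasure a r).real (Set.Ici b) = 1 := by
  have := isProbabilityMeasure_gammaMeasure ha hr
  rw [← Set.compl_Iio, probReal_compl_eq_one_sub measurableSet_Iio, measureReal_def,
    gammaMeasure_Iio_of_nonpos a r hb, ENNReal.toReal_zero, sub_zero]

lemma gammaMeasure_real_Ici_of_nonneg {k : ℕ} (hk : 0 < k) {l : ℝ} (hl : 0 < l) {b : ℝ}
    (hb : 0 ≤ b) :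
    (gammaMeasure k l).real (Set.Ici b) =
      ∑ i ∈ Finset.range k, (l * b) ^ i / (i.factorial : ℝ) * Real.exp (-(l * b)) := by
  obtain ⟨j, rfl⟩ := Nat.exists_eq_add_one_of_ne_zero hk.ne'
  have hl' : (l : ℂ) ≠ 0 := Complex.ofReal_ne_zero.mpr hl.ne'
  have h := setIntegral_Ici_exp_mul_gammaMeasure j hl (z := 0) (by simpa using hl) hb
  simp only [zero_mul, Complex.exp_zero, sub_zero, div_self hl', one_pow, one_mul,
    setIntegral_const, Complex.real_smul, mul_one, Finset.mul_sum] at h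
  apply Complex.ofReal_injective
  rw [h]
  push_cast
  exact Finset.sum_congr rfl fun i _ => mul_comm _ _

lemma gammaMeasure_map_neg_real_Ici {a r : ℝ} (ha : 0 < a) (hr : 0 < r) (b : ℝ) :
    ((gammaMeasure a r).map Neg.neg).real (Set.Ici b) =
      1 - (gammaMeasure a r).real (Set.Ici (-b)) := by
  have := isProbabilityMeasure_gammaMeasure ha hr
  have hpre : Neg.neg ⁻¹' Set.Ici b = Set.Iic (-b) := by
    ext x
    exact le_neg (a := b)
  rw [map_measureReal_apply measurable_neg measurableSet_Ici, hpre,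
    ← probReal_compl_eq_one_sub measurableSet_Ici, Set.compl_Ici]
  exact measureReal_congr ((withDensity_absolutelyContinuous _ _).ae_eq Iio_ae_eq_Iic.symm)

lemma integrable_exp_mul_of_complexMGF_ne_zero {μ : Measure ℝ} {s : ℝ}
    (h : complexMGF id μ s ≠ 0) : Integrable (fun x => Real.exp (s * x)) μ := by
  contrapose! h
  exact complexMGF_undef aemeasurable_id (by simpa using h)

lemma complexMGF_id_map_neg (μ : Measure ℝ) (z : ℂ) :
    complexMGF id (μ.map Neg.neg) z = complexMGF id μ (-z) := by
  rw [complexMGF_id_map measurable_neg.aemeasurable]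
  simp only [complexMGF, id_eq, Complex.ofReal_neg, mul_neg, neg_mul]

lemma integrable_exp_mul_gammaMeasure {k : ℕ} (hk : 0 < k) {l : ℝ} (hl : 0 < l) {s : ℝ}
    (hs : s < l) : Integrable (fun x => Real.exp (s * x)) (gammaMeasure k l) := by
  apply integrable_exp_mul_of_complexMGF_ne_zero
  rw [complexMGF_gammaMeasure hk hl (by simpa using hs), ← Complex.ofReal_sub,
    ← Complex.ofReal_div, ← Complex.ofReal_pow]
  exact Complex.ofReal_ne_zero.mpr (pow_pos (div_pos hl (sub_pos.mpr hs)) k).ne'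

/-! ### Mixtures -/

/-- The mixture `∑ wᵢ μᵢ` of the measures `μᵢ` with real weights `wᵢ`; it has the expected meaning
only for nonnegative weights, a negative weight being truncated to `0`. -/
noncomputable def mixture {ι α : Type*} [MeasurableSpace α] (w : ι → ℝ) (μ : ι → Measure α) :
    Measure α :=
  Measure.sum fun i => ENNReal.ofReal (w i) • μ i

section Mixture

variable {ι α E : Type*} [MeasurableSpace α] [NormedAddCommGroup E]
  {w : ι → ℝ} {μ : ι → Measure α}

lemma isProbabilityMeasure_mixture [∀ i, IsProbabilityMeasure (μ i)] (hw : ∀ i, 0 ≤ w i)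
    (hsum : HasSum w 1) : IsProbabilityMeasure (mixture w μ) where
  measure_univ := by
    simp only [mixture, Measure.sum_apply _ MeasurableSet.univ, Measure.smul_apply, measure_univ,
      smul_eq_mul, mul_one]
    rw [← ENNReal.ofReal_tsum_of_nonneg hw hsum.summable, hsum.tsum_eq, ENNReal.ofReal_one]

lemma integrable_mixture [Countable ι] (hw : ∀ i, 0 ≤ w i) {f : α → E}
    (hf : ∀ i, Integrable f (μ i)) (hsum : Summable fun i => w i * ∫ x, ‖f x‖ ∂μ i) :
    Integrable f (mixture w μ) := by
  refine integrable_sum_measure (fun i => (hf i).smul_measure ENNReal.ofReal_ne_top) ?_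
  simpa only [integral_smul_measure, ENNReal.toReal_ofReal (hw _), smul_eq_mul] using hsum

lemma hasSum_integral_mixture [NormedSpace ℝ E] (hw : ∀ i, 0 ≤ w i) {f : α → E}
    (hf : Integrable f (mixture w μ)) :
    HasSum (fun i => w i • ∫ x, f x ∂μ i) (∫ x, f x ∂mixture w μ) := by
  simpa only [mixture, integral_smul_measure, ENNReal.toReal_ofReal (hw _)] using
    hasSum_integral_measure hf

lemma hasSum_measureReal_mixture [IsFiniteMeasure (mixture w μ)] (hw : ∀ i, 0 ≤ w i) {s : Set α}
    (hs : MeasurableSet s) :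
    HasSum (fun i => w i * (μ i).real s) ((mixture w μ).real s) := by
  simpa only [integral_indicator_one hs, smul_eq_mul] using hasSum_integral_mixture hw
    (f := s.indicator (1 : α → ℝ)) ((integrable_const 1).indicator hs)

lemma hasSum_complexMGF_mixture (hw : ∀ i, 0 ≤ w i) {X : α → ℝ} (hX : Measurable X) {z : ℂ}
    (hint : Integrable (fun x => Real.exp (z.re * X x)) (mixture w μ)) :
    HasSum (fun i => w i * complexMGF X (μ i) z) (complexMGF X (mixture w μ) z) := by
  simpa only [complexMGF, Complex.real_smul] using hasSum_integral_mixture hw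
    (integrable_cexp_mul_of_re_mem_integrableExpSet hX.aemeasurable hint)

end Mixture

/-! ### Partial fractions -/

lemma sum_choose_mul_pow_succ {R : Type*} [CommRing R] (α β A : R) (i j : ℕ) :
    ∑ k ∈ Finset.Icc 1 (i + 1), ((i + 1 + (j + 1) - k - 1).choose (i + 1 - k) : R) *
        β ^ (i + 1 - k) * α ^ (j + 1) * A ^ k =
      α * ∑ k ∈ Finset.Icc 1 (i + 1), ((i + 1 + j - k - 1).choose (i + 1 - k) : R) *
        β ^ (i + 1 - k) * α ^ j * A ^ k +
      β * ∑ k ∈ Finset.Icc 1 i, ((i + (j + 1) - k - 1).choose (i - k) : R) *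
        β ^ (i - k) * α ^ (j + 1) * A ^ k := by
  rw [Finset.sum_Icc_succ_top (by omega), Finset.sum_Icc_succ_top (by omega), mul_add,
    Finset.mul_sum, Finset.mul_sum, add_right_comm (Finset.sum _ _), ← Finset.sum_add_distrib]
  congr 1
  · refine Finset.sum_congr rfl fun k hk => ?_
    obtain ⟨d, rfl⟩ := Nat.exists_eq_add_of_le (Finset.mem_Icc.mp hk).2
    rw [show k + d + 1 + (j + 1) - k - 1 = d + j + 1 by omega,
      show k + d + 1 - k = d + 1 by omega, show k + d + 1 + j - k - 1 = d + j by omega,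
      show k + d + (j + 1) - k - 1 = d + j by omega, show k + d - k = d by omega,
      Nat.choose_succ_succ]
    push_cast
    ring
  · simp only [tsub_self, Nat.choose_zero_right, Nat.cast_one, pow_zero]
    ring

lemma sum_choose_pred_mul_pow {R : Type*} [CommRing R] (β A : R) {i : ℕ} (hi : i ≠ 0) :
    ∑ k ∈ Finset.Icc 1 i, ((i - k - 1).choose (i - k) : R) * β ^ (i - k) * A ^ k = A ^ i := by
  rw [Finset.sum_eq_single_of_mem i (Finset.mem_Icc.mpr ⟨by omega, le_rfl⟩)]
  · simp
  · intro k hk hki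
    rw [Nat.choose_eq_zero_of_lt (by have := (Finset.mem_Icc.mp hk).2; omega)]
    simp

-- For `A = l₁ / (l₁ - z)` and `B = l₂ / (l₂ + z)` the hypothesis holds with
-- `α = l₂ / (l₁ + l₂)` and `β = l₁ / (l₁ + l₂)`.
lemma pow_mul_pow_eq_sum_add_sum {R : Type*} [CommRing R] {A B α β : R}
    (h : A * B = α * A + β * B) (i j : ℕ) (hij : i + j ≠ 0) :
    A ^ i * B ^ j =
      ∑ k ∈ Finset.Icc 1 i, ((i + j - k - 1).choose (i - k) : R) * β ^ (i - k) * α ^ j * A ^ k +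
      ∑ k ∈ Finset.Icc 1 j, ((j + i - k - 1).choose (j - k) : R) * α ^ (j - k) * β ^ i * B ^ k := by
  induction i generalizing j with
  | zero => simpa using (sum_choose_pred_mul_pow α B (by omega : j ≠ 0)).symm
  | succ i ihi =>
    induction j with
    | zero => simpa using (sum_choose_pred_mul_pow β A i.succ_ne_zero).symm
    | succ j ihj =>
      have hstep : A ^ (i + 1) * B ^ (j + 1) =
          α * (A ^ (i + 1) * B ^ j) + β * (A ^ i * B ^ (j + 1)) := by
        rw [pow_succ, pow_succ]
        linear_combination A ^ i * B ^ j * h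
      rw [sum_choose_mul_pow_succ α β A i j, sum_choose_mul_pow_succ β α B j i, hstep,
        ihj (by omega), ihi (j + 1) (by omega)]
      ring

lemma kouQ_eq_kouP (p l₁ l₂ : ℝ) (n k : ℕ) : kouQ p l₁ l₂ n k = kouP (1 - p) l₂ l₁ n k := by
  rw [kouQ, kouP, add_comm l₂ l₁, sub_sub_cancel]
  split_ifs
  · rfl
  · exact Finset.sum_congr rfl fun i _ => by ring

lemma kouP_eq_sum_Icc (p l₁ l₂ : ℝ) {n k : ℕ} (hk : 1 ≤ k) (hkn : k ≤ n) :
    kouP p l₁ l₂ n k = ∑ i ∈ Finset.Icc k n, ((n - k - 1).choose (i - k) : ℝ) * (n.choose i : ℝ) *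
      (l₁ / (l₁ + l₂)) ^ (i - k) * (l₂ / (l₁ + l₂)) ^ (n - i) * p ^ i * (1 - p) ^ (n - i) := by
  rcases hkn.eq_or_lt with rfl | hlt
  · simp [kouP]
  · obtain ⟨m, rfl⟩ := Nat.exists_eq_add_one_of_ne_zero (by omega : n ≠ 0)
    rw [kouP, if_neg hlt.ne, Finset.sum_Icc_succ_top hkn,
      Nat.choose_eq_zero_of_lt (n := m + 1 - k - 1) (by omega)]
    simp

lemma kouP_nonneg {p l₁ l₂ : ℝ} (hp : 0 ≤ p) (hp1 : p ≤ 1) (hl₁ : 0 ≤ l₁) (hl₂ : 0 ≤ l₂)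
    (n k : ℕ) : 0 ≤ kouP p l₁ l₂ n k := by
  have := sub_nonneg.mpr hp1
  unfold kouP
  positivity

lemma kouQ_nonneg {p l₁ l₂ : ℝ} (hp : 0 ≤ p) (hp1 : p ≤ 1) (hl₁ : 0 ≤ l₁) (hl₂ : 0 ≤ l₂)
    (n k : ℕ) : 0 ≤ kouQ p l₁ l₂ n k := by
  rw [kouQ_eq_kouP]
  exact kouP_nonneg (sub_nonneg.mpr hp1) (sub_le_self 1 hp) hl₂ hl₁ n k

lemma sum_kouP_mul_pow (p l₁ l₂ : ℝ) (A : ℂ) (n : ℕ) :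
    ∑ k ∈ Finset.Icc 1 n, (kouP p l₁ l₂ n k : ℂ) * A ^ k =
      ∑ i ∈ Finset.range (n + 1), ((p : ℂ) ^ i * (1 - p) ^ (n - i) * (n.choose i : ℂ)) *
        ∑ k ∈ Finset.Icc 1 i, ((i + (n - i) - k - 1).choose (i - k) : ℂ) *
          (l₁ / (l₁ + l₂) : ℂ) ^ (i - k) * (l₂ / (l₁ + l₂) : ℂ) ^ (n - i) * A ^ k := by
  simp_rw [Finset.mul_sum]
  rw [Finset.sum_comm' (t' := Finset.Icc 1 n) (s' := fun k => Finset.Icc k n)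
    (by intro x y; simp only [Finset.mem_range, Finset.mem_Icc]; omega)]
  refine Finset.sum_congr rfl fun k hk => ?_
  obtain ⟨hk1, hkn⟩ := Finset.mem_Icc.mp hk
  rw [kouP_eq_sum_Icc p l₁ l₂ hk1 hkn]
  push_cast
  rw [Finset.sum_mul]
  refine Finset.sum_congr rfl fun i hi => ?_
  rw [Nat.add_sub_cancel' (Finset.mem_Icc.mp hi).2]
  ring

lemma sum_kouP_mul_pow_add_sum_kouQ_mul_pow (p : ℝ) {l₁ l₂ : ℝ} {A B : ℂ}
    (h : A * B = l₂ / (l₁ + l₂) * A + l₁ / (l₁ + l₂) * B) {n : ℕ} (hn : n ≠ 0) :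
    ∑ k ∈ Finset.Icc 1 n, (kouP p l₁ l₂ n k : ℂ) * A ^ k +
        ∑ k ∈ Finset.Icc 1 n, (kouQ p l₁ l₂ n k : ℂ) * B ^ k =
      (p * A + (1 - p) * B) ^ n := by
  simp_rw [kouQ_eq_kouP]
  rw [sum_kouP_mul_pow, sum_kouP_mul_pow, add_pow,
    ← Finset.sum_range_reflect (n := n + 1) (f := fun i => (((1 - p : ℝ) : ℂ) ^ i *
      (1 - ((1 - p : ℝ) : ℂ)) ^ (n - i) * (n.choose i : ℂ)) * _), ← Finset.sum_add_distrib]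
  refine Finset.sum_congr rfl fun i hi => ?_
  have hin : i ≤ n := Nat.lt_succ_iff.mp (Finset.mem_range.mp hi)
  have hq : 1 - ((1 - p : ℝ) : ℂ) = p := by push_cast; ring
  rw [Nat.add_sub_cancel, Nat.sub_sub_self hin, hq, Nat.choose_symm hin, mul_pow, mul_pow,
    mul_mul_mul_comm, pow_mul_pow_eq_sum_add_sum h i (n - i) (by omega), add_comm (l₂ : ℂ) l₁]
  push_cast
  ring

lemma sum_kouP_add_sum_kouQ (p : ℝ) {l₁ l₂ : ℝ} (h : l₁ + l₂ ≠ 0) {n : ℕ} (hn : n ≠ 0) :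
    ∑ k ∈ Finset.Icc 1 n, kouP p l₁ l₂ n k + ∑ k ∈ Finset.Icc 1 n, kouQ p l₁ l₂ n k = 1 := by
  have h' : (l₁ : ℂ) + l₂ ≠ 0 := by exact_mod_cast h
  have hsum := sum_kouP_mul_pow_add_sum_kouQ_mul_pow p (l₁ := l₁) (l₂ := l₂) (A := 1) (B := 1)
    (by field_simp; ring) hn
  simp only [one_pow, mul_one, add_sub_cancel] at hsum
  exact_mod_cast hsum

/-! ### The double exponential compound Poisson law -/

/-- The coefficients `P_{n,k}` and `Q_{n,k}`, `1 ≤ k ≤ n`, as one family of mixture weights. -/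
noncomputable def kouGammaWeight (p l₁ l₂ : ℝ) (n : ℕ) :
    Finset.Icc 1 n ⊕ Finset.Icc 1 n → ℝ :=
  Sum.elim (fun k => kouP p l₁ l₂ n k) fun k => kouQ p l₁ l₂ n k

/-- The components of the law of `n` double exponential jumps: gamma laws of shape `k` and rate
`l₁`, weighted by `P_{n,k}`, and reflected gamma laws of shape `k` and rate `l₂`, weighted by
`Q_{n,k}`. -/
noncomputable def kouGammaLaw (l₁ l₂ : ℝ) (n : ℕ) :
    Finset.Icc 1 n ⊕ Finset.Icc 1 n → Measure ℝ :=
  Sum.elim (fun k => gammaMeasure (k : ℕ) l₁) fun k => (gammaMeasure (k : ℕ) l₂).map Neg.neg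

/-- The law of a sum of `n` independent jumps with density `p l₁ e^{-l₁ x}` on `x ≥ 0` and
`(1 - p) l₂ e^{l₂ x}` on `x < 0`, defined directly as a mixture of gamma laws; that it is a
convolution power is the content of `complexMGF_kouJumpLaw`. -/
noncomputable def kouJumpLaw (p l₁ l₂ : ℝ) : ℕ → Measure ℝ
  | 0 => Measure.dirac 0
  | n + 1 => mixture (kouGammaWeight p l₁ l₂ (n + 1)) (kouGammaLaw l₁ l₂ (n + 1))

/-- The moment generating function of a single double exponential jump, on `-l₂ < Re z < l₁`. -/
noncomputable def kouJumpMGF (p l₁ l₂ : ℝ) (z : ℂ) : ℂ :=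
  p * (l₁ / (l₁ - z)) + (1 - p) * (l₂ / (l₂ + z))

/-- The law at time `T` of a driftless compound Poisson process with intensity `lam` and double
exponential jumps. -/
noncomputable def kouLaw (lam p l₁ l₂ T : ℝ) : Measure ℝ :=
  mixture (kouWeight lam T) (kouJumpLaw p l₁ l₂)

section KouJumpLaw

variable {p l₁ l₂ : ℝ}

lemma kouGammaWeight_nonneg (hp : 0 ≤ p) (hp1 : p ≤ 1) (hl₁ : 0 ≤ l₁) (hl₂ : 0 ≤ l₂) (n : ℕ)
    (i : Finset.Icc 1 n ⊕ Finset.Icc 1 n) : 0 ≤ kouGammaWeight p l₁ l₂ n i := by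
  rcases i with k | k
  · exact kouP_nonneg hp hp1 hl₁ hl₂ n k
  · exact kouQ_nonneg hp hp1 hl₁ hl₂ n k

lemma sum_kouGammaWeight (p : ℝ) (h : l₁ + l₂ ≠ 0) {n : ℕ} (hn : n ≠ 0) :
    ∑ i, kouGammaWeight p l₁ l₂ n i = 1 := by
  rw [← sum_kouP_add_sum_kouQ p h hn, Fintype.sum_sum_type,
    ← Finset.sum_attach (Finset.Icc 1 n), ← Finset.sum_attach (Finset.Icc 1 n)]
  rfl

lemma isProbabilityMeasure_kouGammaLaw (hl₁ : 0 < l₁) (hl₂ : 0 < l₂) (n : ℕ)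
    (i : Finset.Icc 1 n ⊕ Finset.Icc 1 n) : IsProbabilityMeasure (kouGammaLaw l₁ l₂ n i) := by
  have hpos (k : Finset.Icc 1 n) : (0 : ℝ) < (k : ℕ) :=
    Nat.cast_pos.mpr (Finset.mem_Icc.mp k.2).1
  rcases i with k | k
  · exact isProbabilityMeasure_gammaMeasure (hpos k) hl₁
  · have := isProbabilityMeasure_gammaMeasure (hpos k) hl₂
    exact Measure.isProbabilityMeasure_map measurable_neg.aemeasurable

lemma isProbabilityMeasure_kouJumpLaw (hp : 0 ≤ p) (hp1 : p ≤ 1) (hl₁ : 0 < l₁) (hl₂ : 0 < l₂)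
    (n : ℕ) : IsProbabilityMeasure (kouJumpLaw p l₁ l₂ n) := by
  have := isProbabilityMeasure_kouGammaLaw hl₁ hl₂ n
  cases n with
  | zero => exact Measure.dirac.isProbabilityMeasure
  | succ n =>
    refine isProbabilityMeasure_mixture (kouGammaWeight_nonneg hp hp1 hl₁.le hl₂.le _) ?_
    rw [← sum_kouGammaWeight p (add_pos hl₁ hl₂).ne' n.succ_ne_zero]
    exact hasSum_fintype _

lemma integrable_exp_mul_kouGammaLaw (hl₁ : 0 < l₁) (hl₂ : 0 < l₂) {s : ℝ} (hs₁ : s < l₁)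
    (hs₂ : -l₂ < s) (n : ℕ) (i : Finset.Icc 1 n ⊕ Finset.Icc 1 n) :
    Integrable (fun x => Real.exp (s * x)) (kouGammaLaw l₁ l₂ n i) := by
  rcases i with k | k
  · exact integrable_exp_mul_gammaMeasure (Finset.mem_Icc.mp k.2).1 hl₁ hs₁
  · rw [kouGammaLaw, Sum.elim_inr, integrable_map_measure (by fun_prop) (by fun_prop)]
    simpa only [Function.comp_def, neg_mul, mul_neg] using
      integrable_exp_mul_gammaMeasure (Finset.mem_Icc.mp k.2).1 hl₂ (neg_lt.mp hs₂)

lemma integrable_exp_mul_kouJumpLaw (hp : 0 ≤ p) (hp1 : p ≤ 1) (hl₁ : 0 < l₁) (hl₂ : 0 < l₂)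
    {s : ℝ} (hs₁ : s < l₁) (hs₂ : -l₂ < s) (n : ℕ) :
    Integrable (fun x => Real.exp (s * x)) (kouJumpLaw p l₁ l₂ n) := by
  cases n with
  | zero => exact integrable_dirac (by simp)
  | succ n =>
    exact integrable_mixture (kouGammaWeight_nonneg hp hp1 hl₁.le hl₂.le _)
      (integrable_exp_mul_kouGammaLaw hl₁ hl₂ hs₁ hs₂ _) (hasSum_fintype _).summable

lemma complexMGF_kouGammaLaw_inl (hl₁ : 0 < l₁) (l₂ : ℝ) {z : ℂ} (hz : z.re < l₁) {n : ℕ}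
    (k : Finset.Icc 1 n) :
    complexMGF id (kouGammaLaw l₁ l₂ n (Sum.inl k)) z = (l₁ / (l₁ - z)) ^ (k : ℕ) :=
  complexMGF_gammaMeasure (Finset.mem_Icc.mp k.2).1 hl₁ hz

lemma complexMGF_kouGammaLaw_inr (l₁ : ℝ) (hl₂ : 0 < l₂) {z : ℂ} (hz : -l₂ < z.re) {n : ℕ}
    (k : Finset.Icc 1 n) :
    complexMGF id (kouGammaLaw l₁ l₂ n (Sum.inr k)) z = (l₂ / (l₂ + z)) ^ (k : ℕ) := by
  rw [kouGammaLaw, Sum.elim_inr, complexMGF_id_map_neg,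
    complexMGF_gammaMeasure (Finset.mem_Icc.mp k.2).1 hl₂ (by simpa using neg_lt.mp hz),
    sub_neg_eq_add]

lemma div_sub_mul_div_add_eq {l₁ l₂ z : ℂ} (h : l₁ + l₂ ≠ 0) (h₁ : l₁ - z ≠ 0)
    (h₂ : l₂ + z ≠ 0) :
    l₁ / (l₁ - z) * (l₂ / (l₂ + z)) =
      l₂ / (l₁ + l₂) * (l₁ / (l₁ - z)) + l₁ / (l₁ + l₂) * (l₂ / (l₂ + z)) := by
  field_simp
  ring

lemma complexMGF_kouJumpLaw (hp : 0 ≤ p) (hp1 : p ≤ 1) (hl₁ : 0 < l₁) (hl₂ : 0 < l₂) {z : ℂ}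
    (hz₁ : z.re < l₁) (hz₂ : -l₂ < z.re) (n : ℕ) :
    complexMGF id (kouJumpLaw p l₁ l₂ n) z = kouJumpMGF p l₁ l₂ z ^ n := by
  cases n with
  | zero => simp [kouJumpLaw, complexMGF]
  | succ n =>
    have h : (l₁ : ℂ) + l₂ ≠ 0 := by exact_mod_cast (add_pos hl₁ hl₂).ne'
    have h₁ : (l₁ : ℂ) - z ≠ 0 := sub_ne_zero.mpr (by rintro rfl; simp at hz₁)
    have h₂ : (l₂ : ℂ) + z ≠ 0 := fun h => by
      rw [← neg_eq_iff_add_eq_zero.mpr h] at hz₂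
      simp at hz₂
    have hsum := hasSum_complexMGF_mixture (kouGammaWeight_nonneg hp hp1 hl₁.le hl₂.le (n + 1))
      measurable_id (integrable_exp_mul_kouJumpLaw hp hp1 hl₁ hl₂ hz₁ hz₂ (n + 1))
    rw [kouJumpLaw, ← (hasSum_fintype _).unique hsum, Fintype.sum_sum_type]
    simp only [complexMGF_kouGammaLaw_inl hl₁ l₂ hz₁, complexMGF_kouGammaLaw_inr l₁ hl₂ hz₂,
      kouGammaWeight, Sum.elim_inl, Sum.elim_inr]
    rw [kouJumpMGF, ← sum_kouP_mul_pow_add_sum_kouQ_mul_pow p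
        (div_sub_mul_div_add_eq h h₁ h₂) n.succ_ne_zero,
      ← Finset.sum_attach (Finset.Icc 1 _), ← Finset.sum_attach (Finset.Icc 1 _)]
    rfl

end KouJumpLaw

section KouLaw

variable {lam p l₁ l₂ T : ℝ}

lemma kouWeight_nonneg (h : 0 ≤ lam * T) (n : ℕ) : 0 ≤ kouWeight lam T n := by
  unfold kouWeight
  positivity

lemma hasSum_kouWeight_mul_pow (lam T : ℝ) (z : ℂ) :
    HasSum (fun n => kouWeight lam T n * z ^ n) (Complex.exp (lam * T * (z - 1))) := by
  have h := (NormedSpace.expSeries_div_hasSum_exp (lam * T * z : ℂ)).mul_left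
    (Complex.exp (-(lam * T)))
  rw [← Complex.exp_eq_exp_ℂ, ← Complex.exp_add, ← sub_eq_neg_add, ← mul_sub_one] at h
  refine h.congr_fun fun n => ?_
  rw [kouWeight]
  push_cast
  ring

lemma hasSum_kouWeight (lam T : ℝ) : HasSum (kouWeight lam T) 1 := by
  have h := hasSum_kouWeight_mul_pow lam T 1
  simp only [one_pow, mul_one, sub_self, mul_zero, Complex.exp_zero] at h
  exact Complex.hasSum_ofReal.mp (by simpa only [Complex.ofReal_one] using h)

lemma isProbabilityMeasure_kouLaw (hT : 0 ≤ lam * T) (hp : 0 ≤ p) (hp1 : p ≤ 1) (hl₁ : 0 < l₁)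
    (hl₂ : 0 < l₂) : IsProbabilityMeasure (kouLaw lam p l₁ l₂ T) :=
  have := isProbabilityMeasure_kouJumpLaw hp hp1 hl₁ hl₂
  isProbabilityMeasure_mixture (kouWeight_nonneg hT) (hasSum_kouWeight lam T)

lemma integrable_exp_mul_kouLaw (hT : 0 ≤ lam * T) (hp : 0 ≤ p) (hp1 : p ≤ 1) (hl₁ : 0 < l₁)
    (hl₂ : 0 < l₂) {s : ℝ} (hs₁ : s < l₁) (hs₂ : -l₂ < s) :
    Integrable (fun x => Real.exp (s * x)) (kouLaw lam p l₁ l₂ T) := by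
  refine integrable_mixture (kouWeight_nonneg hT)
    (integrable_exp_mul_kouJumpLaw hp hp1 hl₁ hl₂ hs₁ hs₂) ?_
  rw [← Complex.summable_ofReal]
  refine (hasSum_kouWeight_mul_pow lam T (kouJumpMGF p l₁ l₂ s)).summable.congr fun n => ?_
  rw [← complexMGF_kouJumpLaw hp hp1 hl₁ hl₂ (by simpa) (by simpa), complexMGF_ofReal]
  simp [mgf]

lemma complexMGF_kouLaw (hT : 0 ≤ lam * T) (hp : 0 ≤ p) (hp1 : p ≤ 1) (hl₁ : 0 < l₁)
    (hl₂ : 0 < l₂) {z : ℂ} (hz₁ : z.re < l₁) (hz₂ : -l₂ < z.re) :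
    complexMGF id (kouLaw lam p l₁ l₂ T) z =
      Complex.exp (lam * T * (kouJumpMGF p l₁ l₂ z - 1)) := by
  refine (hasSum_complexMGF_mixture (kouWeight_nonneg hT) measurable_id
    (integrable_exp_mul_kouLaw hT hp hp1 hl₁ hl₂ hz₁ hz₂)).unique ?_
  simp only [complexMGF_kouJumpLaw hp hp1 hl₁ hl₂ hz₁ hz₂]
  exact hasSum_kouWeight_mul_pow lam T _

end KouLaw

section KouPsi

variable {lam p l₁ l₂ T : ℝ}

lemma kouPosTerm_eq_sum_gammaMeasure (lam p : ℝ) (hl₁ : 0 < l₁) (l₂ b T : ℝ) (n : ℕ) :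
    kouPosTerm lam p l₁ l₂ b T n = kouWeight lam T n *
      ∑ k ∈ Finset.Icc 1 n, kouP p l₁ l₂ n k * (gammaMeasure k l₁).real (Set.Ici b) := by
  refine congrArg _ (Finset.sum_congr rfl fun k hk => ?_)
  have hk : 0 < k := (Finset.mem_Icc.mp hk).1
  rcases le_or_gt 0 b with hb | hb
  · rw [gammaMeasure_real_Ici_of_nonneg hk hl₁ hb, if_pos hb, if_neg hb.not_gt, mul_one, add_zero]
  · rw [gammaMeasure_real_Ici_of_nonpos (Nat.cast_pos.mpr hk) hl₁ hb.le, if_neg hb.not_ge,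
      if_pos hb, mul_zero, zero_add]

lemma kouNegTerm_eq_sum_gammaMeasure (lam p l₁ : ℝ) (hl₂ : 0 < l₂) (b T : ℝ) (n : ℕ) :
    kouNegTerm lam p l₁ l₂ b T n = kouWeight lam T n * ∑ k ∈ Finset.Icc 1 n,
      kouQ p l₁ l₂ n k * ((gammaMeasure k l₂).map Neg.neg).real (Set.Ici b) := by
  refine congrArg _ (Finset.sum_congr rfl fun k hk => ?_)
  have hk : 0 < k := (Finset.mem_Icc.mp hk).1
  rw [gammaMeasure_map_neg_real_Ici (Nat.cast_pos.mpr hk) hl₂, mul_assoc]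
  rcases lt_or_ge b 0 with hb | hb
  · simp only [if_pos hb, mul_one, gammaMeasure_real_Ici_of_nonneg hk hl₂ (neg_nonneg.mpr hb.le),
      mul_neg, neg_neg]
  · rw [if_neg hb.not_gt, mul_zero,
      gammaMeasure_real_Ici_of_nonpos (Nat.cast_pos.mpr hk) hl₂ (neg_nonpos.mpr hb), sub_self]

lemma kouPosTerm_nonneg (hT : 0 ≤ lam * T) (hp : 0 ≤ p) (hp1 : p ≤ 1) (hl₁ : 0 < l₁)
    (hl₂ : 0 ≤ l₂) (b : ℝ) (n : ℕ) : 0 ≤ kouPosTerm lam p l₁ l₂ b T n := by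
  rw [kouPosTerm_eq_sum_gammaMeasure lam p hl₁]
  exact mul_nonneg (kouWeight_nonneg hT n) (Finset.sum_nonneg fun k _ =>
    mul_nonneg (kouP_nonneg hp hp1 hl₁.le hl₂ n k) measureReal_nonneg)

lemma kouNegTerm_nonneg (hT : 0 ≤ lam * T) (hp : 0 ≤ p) (hp1 : p ≤ 1) (hl₁ : 0 ≤ l₁)
    (hl₂ : 0 < l₂) (b : ℝ) (n : ℕ) : 0 ≤ kouNegTerm lam p l₁ l₂ b T n := by
  rw [kouNegTerm_eq_sum_gammaMeasure lam p l₁ hl₂]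
  exact mul_nonneg (kouWeight_nonneg hT n) (Finset.sum_nonneg fun k _ =>
    mul_nonneg (kouQ_nonneg hp hp1 hl₁ hl₂.le n k) measureReal_nonneg)

lemma kouPosTerm_add_kouNegTerm (lam T b : ℝ) (hp : 0 ≤ p) (hp1 : p ≤ 1) (hl₁ : 0 < l₁)
    (hl₂ : 0 < l₂) (n : ℕ) :
    kouPosTerm lam p l₁ l₂ b T (n + 1) + kouNegTerm lam p l₁ l₂ b T (n + 1) =
      kouWeight lam T (n + 1) * (kouJumpLaw p l₁ l₂ (n + 1)).real (Set.Ici b) := by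
  have : IsProbabilityMeasure
      (mixture (kouGammaWeight p l₁ l₂ (n + 1)) (kouGammaLaw l₁ l₂ (n + 1))) :=
    isProbabilityMeasure_kouJumpLaw hp hp1 hl₁ hl₂ (n + 1)
  rw [kouPosTerm_eq_sum_gammaMeasure lam p hl₁, kouNegTerm_eq_sum_gammaMeasure lam p l₁ hl₂,
    ← mul_add, kouJumpLaw, ← (hasSum_fintype _).unique (hasSum_measureReal_mixture
      (kouGammaWeight_nonneg hp hp1 hl₁.le hl₂.le (n + 1)) measurableSet_Ici),
    Fintype.sum_sum_type, ← Finset.sum_attach (Finset.Icc 1 _),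
    ← Finset.sum_attach (Finset.Icc 1 _)]
  rfl

lemma hasSum_kouPosTerm_add_kouNegTerm (hT : 0 ≤ lam * T) (hp : 0 ≤ p) (hp1 : p ≤ 1)
    (hl₁ : 0 < l₁) (hl₂ : 0 < l₂) (b : ℝ) :
    HasSum (fun n => kouPosTerm lam p l₁ l₂ b T (n + 1) + kouNegTerm lam p l₁ l₂ b T (n + 1))
      ((kouLaw lam p l₁ l₂ T).real (Set.Ici b) - kouWeight lam T 0 * if b ≤ 0 then 1 else 0) := by
  have : IsProbabilityMeasure (mixture (kouWeight lam T) (kouJumpLaw p l₁ l₂)) :=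
    isProbabilityMeasure_kouLaw hT hp hp1 hl₁ hl₂
  have hzero : (kouJumpLaw p l₁ l₂ 0).real (Set.Ici b) = if b ≤ 0 then 1 else 0 := by
    simp [kouJumpLaw, measureReal_def, Set.indicator_apply, apply_ite]
  simp only [kouPosTerm_add_kouNegTerm lam T b hp hp1 hl₁ hl₂]
  rw [← hzero, ← Finset.sum_range_one fun n =>
    kouWeight lam T n * (kouJumpLaw p l₁ l₂ n).real (Set.Ici b)]
  exact (hasSum_nat_add_iff' 1).mpr
    (hasSum_measureReal_mixture (kouWeight_nonneg hT) measurableSet_Ici)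

theorem kouPsiConverges (μ a : ℝ) (hT : 0 ≤ lam * T) (hp : 0 ≤ p) (hp1 : p ≤ 1) (hl₁ : 0 < l₁)
    (hl₂ : 0 < l₂) : KouPsiConverges μ lam p l₁ l₂ a T := by
  have hsum := (hasSum_kouPosTerm_add_kouNegTerm hT hp hp1 hl₁ hl₂ (a - μ * T)).summable
  have hpos (n : ℕ) := kouPosTerm_nonneg hT hp hp1 hl₁ hl₂.le (a - μ * T) (n + 1)
  have hneg (n : ℕ) := kouNegTerm_nonneg hT hp hp1 hl₁.le hl₂ (a - μ * T) (n + 1)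
  exact ⟨hsum.of_nonneg_of_le hpos fun n => le_add_of_nonneg_right (hneg n),
    hsum.of_nonneg_of_le hneg fun n => le_add_of_nonneg_left (hpos n)⟩

theorem kouPsi_eq_kouLaw_real_Ici (μ a : ℝ) (hT : 0 ≤ lam * T) (hp : 0 ≤ p) (hp1 : p ≤ 1)
    (hl₁ : 0 < l₁) (hl₂ : 0 < l₂) :
    kouPsi μ lam p l₁ l₂ a T = (kouLaw lam p l₁ l₂ T).real (Set.Ici (a - μ * T)) := by
  obtain ⟨hpos, hneg⟩ := kouPsiConverges μ a hT hp hp1 hl₁ hl₂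
  rw [kouPsi, add_assoc, ← hpos.tsum_add hneg,
    (hasSum_kouPosTerm_add_kouNegTerm hT hp hp1 hl₁ hl₂ _).tsum_eq, add_sub_cancel]

end KouPsi

/-! ### Exponential tilting -/

section Tilted

variable {Ω : Type*} {m : MeasurableSpace Ω}

lemma complexMGF_tilted (X : Ω → ℝ) (μ : Measure Ω) (z : ℂ) :
    complexMGF X (μ.tilted X) z = complexMGF X μ (1 + z) / mgf X μ 1 := by
  rw [complexMGF, integral_tilted, complexMGF, ← integral_div]
  refine integral_congr_ae (ae_of_all _ fun ω => ?_)
  simp only [mgf, one_mul, Complex.real_smul, add_mul, Complex.exp_add, Complex.ofReal_div,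
    Complex.ofReal_exp]
  ring

lemma setIntegral_exp_eq_integral_exp_mul_tilted_real {μ : Measure Ω} {f : Ω → ℝ}
    (hf : Integrable (fun ω => Real.exp (f ω)) μ) {s : Set Ω} (hs : MeasurableSet s) :
    ∫ ω in s, Real.exp (f ω) ∂μ = (∫ ω, Real.exp (f ω) ∂μ) * (μ.tilted f).real s := by
  rcases eq_zero_or_neZero μ with rfl | _
  · simp
  · have h := setIntegral_tilted' (μ := μ) f (fun _ => (1 : ℝ)) hs
    simp only [setIntegral_const, smul_eq_mul, mul_one, integral_div] at h
    rw [h, mul_div_cancel₀ _ (integral_exp_pos hf).ne']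

end Tilted

section EsscherTransform

variable {lam p l₁ l₂ T : ℝ}

lemma one_add_kouZeta_mul_kouPStar (h : 1 + kouZeta p (1 - p) l₁ l₂ ≠ 0) :
    (1 + kouZeta p (1 - p) l₁ l₂) * kouPStar p (1 - p) l₁ l₂ = p * (l₁ / (l₁ - 1)) := by
  rw [kouPStar, ← mul_assoc, mul_div_cancel₀ _ h]

lemma one_add_kouZeta_mul_one_sub_kouPStar (h : 1 + kouZeta p (1 - p) l₁ l₂ ≠ 0) :
    (1 + kouZeta p (1 - p) l₁ l₂) * (1 - kouPStar p (1 - p) l₁ l₂) =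
      (1 - p) * (l₂ / (l₂ + 1)) := by
  rw [mul_one_sub, one_add_kouZeta_mul_kouPStar h, kouZeta]
  ring

lemma one_add_kouZeta_pos (hp : 0 ≤ p) (hp1 : p ≤ 1) (hl₁ : 1 < l₁) (hl₂ : 0 < l₂) :
    0 < 1 + kouZeta p (1 - p) l₁ l₂ := by
  have h₁ : 1 < l₁ / (l₁ - 1) := (one_lt_div (sub_pos.mpr hl₁)).mpr (sub_one_lt l₁)
  have h₂ : 0 < l₂ / (l₂ + 1) := by positivity
  have hmix : 1 + kouZeta p (1 - p) l₁ l₂ = p * (l₁ / (l₁ - 1)) + (1 - p) * (l₂ / (l₂ + 1)) := by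
    rw [kouZeta]
    ring
  rw [hmix]
  exact (lt_min (by linarith) h₂).trans_le (Convex.min_le_combo _ _ hp (sub_nonneg.mpr hp1)
    (add_sub_cancel p 1))

lemma kouPStar_nonneg (hp : 0 ≤ p) (hp1 : p ≤ 1) (hl₁ : 1 < l₁) (hl₂ : 0 < l₂) :
    0 ≤ kouPStar p (1 - p) l₁ l₂ :=
  mul_nonneg (div_nonneg hp (one_add_kouZeta_pos hp hp1 hl₁ hl₂).le)
    (div_nonneg (by linarith) (sub_nonneg.mpr hl₁.le))

lemma kouPStar_le_one (hp : 0 ≤ p) (hp1 : p ≤ 1) (hl₁ : 1 < l₁) (hl₂ : 0 < l₂) :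
    kouPStar p (1 - p) l₁ l₂ ≤ 1 := by
  have hζ := one_add_kouZeta_pos hp hp1 hl₁ hl₂
  refine sub_nonneg.mp (nonneg_of_mul_nonneg_right ?_ hζ)
  rw [one_add_kouZeta_mul_one_sub_kouPStar hζ.ne']
  exact mul_nonneg (sub_nonneg.mpr hp1) (by positivity)

lemma kouLamStar_mul_nonneg (hT : 0 ≤ lam * T) (hp : 0 ≤ p) (hp1 : p ≤ 1) (hl₁ : 1 < l₁)
    (hl₂ : 0 < l₂) : 0 ≤ kouLamStar lam p (1 - p) l₁ l₂ * T := by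
  rw [kouLamStar, mul_right_comm, add_comm]
  exact mul_nonneg hT (one_add_kouZeta_pos hp hp1 hl₁ hl₂).le

lemma kouJumpMGF_one (p l₁ l₂ : ℝ) :
    kouJumpMGF p l₁ l₂ 1 = ((1 + kouZeta p (1 - p) l₁ l₂ : ℝ) : ℂ) := by
  rw [kouJumpMGF, kouZeta]
  push_cast
  ring

lemma kouJumpMGF_one_add (hp : 0 ≤ p) (hp1 : p ≤ 1) (hl₁ : 1 < l₁) (hl₂ : 0 < l₂) (z : ℂ) :
    kouJumpMGF p l₁ l₂ (1 + z) = (1 + kouZeta p (1 - p) l₁ l₂ : ℝ) *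
      kouJumpMGF (kouPStar p (1 - p) l₁ l₂) (l₁ - 1) (l₂ + 1) z := by
  have hζ := (one_add_kouZeta_pos hp hp1 hl₁ hl₂).ne'
  have h₁ : (l₁ : ℂ) - 1 ≠ 0 := by exact_mod_cast (sub_pos.mpr hl₁).ne'
  have h₂ : (l₂ : ℂ) + 1 ≠ 0 := by exact_mod_cast (add_pos hl₂ one_pos).ne'
  have hP := congrArg Complex.ofReal (one_add_kouZeta_mul_kouPStar hζ)
  have hQ := congrArg Complex.ofReal (one_add_kouZeta_mul_one_sub_kouPStar hζ)
  rw [kouJumpMGF, kouJumpMGF, mul_add, ← mul_assoc, ← mul_assoc]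
  push_cast at hP hQ ⊢
  rw [hP, hQ, mul_assoc, mul_assoc, div_mul_div_cancel₀ h₁, div_mul_div_cancel₀ h₂, sub_sub,
    add_assoc]

lemma mgf_kouLaw_one (hT : 0 ≤ lam * T) (hp : 0 ≤ p) (hp1 : p ≤ 1) (hl₁ : 1 < l₁) (hl₂ : 0 < l₂) :
    mgf id (kouLaw lam p l₁ l₂ T) 1 = Real.exp (lam * kouZeta p (1 - p) l₁ l₂ * T) := by
  apply Complex.ofReal_injective
  rw [← complexMGF_ofReal, Complex.ofReal_one, complexMGF_kouLaw hT hp hp1 (one_pos.trans hl₁) hl₂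
    (by simpa) (by simpa using (neg_neg_of_pos hl₂).trans one_pos), kouJumpMGF_one]
  push_cast
  ring_nf

lemma charFun_kouLaw (hT : 0 ≤ lam * T) (hp : 0 ≤ p) (hp1 : p ≤ 1) (hl₁ : 0 < l₁) (hl₂ : 0 < l₂)
    (u : ℝ) : charFun (kouLaw lam p l₁ l₂ T) u =
      Complex.exp (lam * T * (kouJumpMGF p l₁ l₂ (u * Complex.I) - 1)) := by
  rw [← complexMGF_id_mul_I, complexMGF_kouLaw hT hp hp1 hl₁ hl₂ (by simpa) (by simpa)]

theorem kouLaw_tilted_id (hT : 0 ≤ lam * T) (hp : 0 ≤ p) (hp1 : p ≤ 1) (hl₁ : 1 < l₁)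
    (hl₂ : 0 < l₂) :
    (kouLaw lam p l₁ l₂ T).tilted id = kouLaw (kouLamStar lam p (1 - p) l₁ l₂)
      (kouPStar p (1 - p) l₁ l₂) (l₁ - 1) (l₂ + 1) T := by
  have hl₁0 : 0 < l₁ := one_pos.trans hl₁
  have hstar := kouLamStar_mul_nonneg hT hp hp1 hl₁ hl₂
  have hp' := kouPStar_nonneg hp hp1 hl₁ hl₂
  have hp1' := kouPStar_le_one hp hp1 hl₁ hl₂
  have := isProbabilityMeasure_kouLaw hstar hp' hp1' (sub_pos.mpr hl₁) (add_pos hl₂ one_pos)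
  refine Measure.ext_of_charFun (funext fun u => ?_)
  rw [charFun_kouLaw hstar hp' hp1' (sub_pos.mpr hl₁) (add_pos hl₂ one_pos),
    ← complexMGF_id_mul_I, complexMGF_tilted, mgf_kouLaw_one hT hp hp1 hl₁ hl₂,
    complexMGF_kouLaw hT hp hp1 hl₁0 hl₂ (by simpa)
      (by simpa using (neg_neg_of_pos hl₂).trans one_pos),
    kouJumpMGF_one_add hp hp1 hl₁ hl₂, Complex.ofReal_exp, ← Complex.exp_sub, kouLamStar]
  push_cast
  ring_nf

end EsscherTransform

lemma integral_call_payoff {ρ : Measure ℝ} [IsFiniteMeasure ρ] (hρ : Integrable Real.exp ρ)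
    {s K : ℝ} (hs : 0 < s) (hK : 0 < K) :
    ∫ x, max (s * Real.exp x - K) 0 ∂ρ =
      s * (∫ x in Set.Ici (Real.log (K / s)), Real.exp x ∂ρ) -
        K * ρ.real (Set.Ici (Real.log (K / s))) := by
  have hpayoff (x : ℝ) : max (s * Real.exp x - K) 0 =
      (Set.Ici (Real.log (K / s))).indicator (fun x => s * Real.exp x - K) x := by
    have hiff : x ∈ Set.Ici (Real.log (K / s)) ↔ 0 ≤ s * Real.exp x - K := by
      rw [Set.mem_Ici, Real.log_le_iff_le_exp (by positivity), div_le_iff₀' hs, sub_nonneg]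
    by_cases h : x ∈ Set.Ici (Real.log (K / s))
    · rw [Set.indicator_of_mem h, max_eq_left (hiff.mp h)]
    · rw [Set.indicator_of_notMem h, max_eq_right (not_le.mp (mt hiff.mpr h)).le]
  rw [integral_congr_ae (ae_of_all _ hpayoff), integral_indicator measurableSet_Ici,
    integral_sub (hρ.const_mul s).integrableOn (integrable_const _), integral_const_mul,
    setIntegral_const, smul_eq_mul, mul_comm K]

theorem integral_call_payoff_kouLaw {lam p l₁ l₂ T : ℝ} (hT : 0 ≤ lam * T) (hp : 0 ≤ p)
    (hp1 : p ≤ 1) (hl₁ : 1 < l₁) (hl₂ : 0 < l₂) {s K : ℝ} (hs : 0 < s) (hK : 0 < K) :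
    ∫ x, max (s * Real.exp (x + -lam * kouZeta p (1 - p) l₁ l₂ * T) - K) 0
        ∂kouLaw lam p l₁ l₂ T =
      s * kouPsi (-lam * kouZeta p (1 - p) l₁ l₂) (kouLamStar lam p (1 - p) l₁ l₂)
          (kouPStar p (1 - p) l₁ l₂) (l₁ - 1) (l₂ + 1) (Real.log (K / s)) T -
        K * kouPsi (-lam * kouZeta p (1 - p) l₁ l₂) lam p l₁ l₂ (Real.log (K / s)) T := by
  have hl₁0 : 0 < l₁ := one_pos.trans hl₁
  have hprob := isProbabilityMeasure_kouLaw hT hp hp1 hl₁0 hl₂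
  have hexp : Integrable (fun x => Real.exp (id x)) (kouLaw lam p l₁ l₂ T) := by
    simpa only [one_mul, id_eq] using integrable_exp_mul_kouLaw hT hp hp1 hl₁0 hl₂ hl₁
      ((neg_neg_of_pos hl₂).trans one_pos)
  have hmgf := mgf_kouLaw_one hT hp hp1 hl₁ hl₂
  simp only [mgf, one_mul] at hmgf
  set d := -lam * kouZeta p (1 - p) l₁ l₂ * T with hd
  have hlog : Real.log (K / (s * Real.exp d)) = Real.log (K / s) - d := by
    rw [← div_div, Real.log_div (by positivity) (by positivity), Real.log_exp]
  have hshift (x : ℝ) : s * Real.exp (x + d) = s * Real.exp d * Real.exp x := by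
    rw [add_comm, Real.exp_add, mul_assoc]
  have htail (a : ℝ) : ∫ x in Set.Ici a, Real.exp x ∂kouLaw lam p l₁ l₂ T = Real.exp (-d) *
      ((kouLaw lam p l₁ l₂ T).tilted id).real (Set.Ici a) := by
    rw [hd, neg_mul, neg_mul, neg_neg, ← hmgf]
    exact setIntegral_exp_eq_integral_exp_mul_tilted_real hexp measurableSet_Ici
  simp only [hshift]
  rw [integral_call_payoff hexp (by positivity) hK, hlog, htail, kouLaw_tilted_id hT hp hp1 hl₁ hl₂,
    kouPsi_eq_kouLaw_real_Ici _ _ (kouLamStar_mul_nonneg hT hp hp1 hl₁ hl₂)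
      (kouPStar_nonneg hp hp1 hl₁ hl₂) (kouPStar_le_one hp hp1 hl₁ hl₂) (sub_pos.mpr hl₁)
      (add_pos hl₂ one_pos), kouPsi_eq_kouLaw_real_Ici _ _ hT hp hp1 hl₁0 hl₂, ← hd, mul_assoc s,
    ← mul_assoc (Real.exp d), ← Real.exp_add, add_neg_cancel, Real.exp_zero, one_mul]

/-! ### The increments of the log-price -/

lemma kouJumpLaw_one (p l₁ l₂ : ℝ) :
    kouJumpLaw p l₁ l₂ 1 = ENNReal.ofReal p • expMeasure l₁ +
      ENNReal.ofReal (1 - p) • (expMeasure l₂).map Neg.neg := by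
  have hsum (f : Finset.Icc 1 1 → Measure ℝ) : ∑ k, f k = f ⟨1, by simp⟩ :=
    Fintype.sum_eq_single _ fun k hk => (hk (Subtype.ext (by simpa using k.2))).elim
  rw [kouJumpLaw, mixture, Measure.sum_fintype, Fintype.sum_sum_type, hsum, hsum]
  simp [kouGammaWeight, kouGammaLaw, kouP, kouQ, expMeasure]

lemma withDensity_kouDensity {lam p l₁ l₂ : ℝ} (hlam : 0 ≤ lam) (hp : 0 ≤ p) (hp1 : p ≤ 1) :
    (volume.withDensity fun x => ENNReal.ofReal (kouDensity lam p (1 - p) l₁ l₂ x)) =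
      ENNReal.ofReal lam • kouJumpLaw p l₁ l₂ 1 := by
  have hpdf (l : ℝ) : Measurable (exponentialPDF l) := measurable_gammaPDF 1 l
  have hpdf_neg (l : ℝ) : Measurable fun x => exponentialPDF l (-x) :=
    (hpdf l).comp measurable_neg
  have hneg : (expMeasure l₂).map Neg.neg = volume.withDensity fun x => exponentialPDF l₂ (-x) :=
    gammaMeasure_map_neg 1 l₂
  have hexp : expMeasure l₁ = volume.withDensity (exponentialPDF l₁) := rfl
  rw [kouJumpLaw_one, hneg, hexp, ← withDensity_smul _ (hpdf l₁),
    ← withDensity_smul _ (hpdf_neg l₂), ← withDensity_add_left ((hpdf l₁).const_smul _),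
    ← withDensity_smul' _ _ ENNReal.ofReal_ne_top]
  refine withDensity_congr_ae ?_
  filter_upwards [Measure.ae_ne volume 0] with x hx
  simp only [Pi.add_apply, Pi.smul_apply, smul_eq_mul]
  rw [kouDensity, ENNReal.ofReal_mul hlam]
  rcases hx.lt_or_gt with h | h
  · rw [if_neg h.not_ge, exponentialPDF_of_neg h, exponentialPDF_of_nonneg (neg_nonneg.mpr h.le),
      mul_zero, zero_add, mul_assoc, ENNReal.ofReal_mul (sub_nonneg.mpr hp1), mul_neg, neg_neg]
  · rw [if_pos h.le, exponentialPDF_of_neg (neg_neg_of_pos h), exponentialPDF_of_nonneg h.le,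
      mul_zero, add_zero, mul_assoc, ENNReal.ofReal_mul hp, neg_mul]

lemma levyExponent_of_isFiniteMeasure (γ σ2 : ℝ) (ν : Measure ℝ) [IsFiniteMeasure ν] (u : ℝ) :
    levyExponent γ σ2 ν u =
      Complex.I * ((γ - ∫ x in Set.Icc (-1) 1, x ∂ν : ℝ) : ℂ) * u - σ2 * u ^ 2 / 2 +
        (charFun ν u - ν.real Set.univ) := by
  have hosc : Integrable (fun x : ℝ => Complex.exp (u * x * Complex.I)) ν :=
    Integrable.of_bound (Continuous.aestronglyMeasurable (by fun_prop)) 1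
      (ae_of_all _ fun x => by rw [← Complex.ofReal_mul, Complex.norm_exp_ofReal_mul_I])
  have hsmall : IntegrableOn (fun x : ℝ => Complex.I * u * x) (Set.Icc (-1) 1) ν :=
    Continuous.integrableOn_Icc (by fun_prop)
  have hsplit (x : ℝ) : Complex.exp (Complex.I * u * x) - 1 -
      (if |x| ≤ 1 then Complex.I * u * x else 0) = Complex.exp (u * x * Complex.I) - 1 -
        (Set.Icc (-1) 1).indicator (fun x : ℝ => Complex.I * u * x) x := by
    rw [show Complex.I * u * x = u * x * Complex.I by ring]
    simp only [Set.indicator, Set.mem_Icc, abs_le]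
    congr 2
    ring
  rw [levyExponent, integral_congr_ae (ae_of_all _ hsplit),
    integral_sub (f := fun x : ℝ => Complex.exp (u * x * Complex.I) - 1)
      (hosc.sub (integrable_const 1)) (hsmall.integrable_indicator measurableSet_Icc),
    integral_sub hosc (integrable_const 1), integral_indicator measurableSet_Icc,
    integral_const_mul, integral_complex_ofReal, integral_const, ← charFun_apply_real,
    Complex.real_smul]
  push_cast
  ring

lemma exists_levyExponent_kouDensity_eq (γ : ℝ) {lam p l₁ l₂ : ℝ} (hlam : 0 ≤ lam) (hp : 0 ≤ p)
    (hp1 : p ≤ 1) (hl₁ : 0 < l₁) (hl₂ : 0 < l₂) :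
    ∃ c : ℝ, ∀ u : ℝ,
      levyExponent γ 0
        (volume.withDensity fun x => ENNReal.ofReal (kouDensity lam p (1 - p) l₁ l₂ x)) u =
          Complex.I * c * u + lam * (kouJumpMGF p l₁ l₂ (u * Complex.I) - 1) := by
  have := isProbabilityMeasure_kouJumpLaw hp hp1 hl₁ hl₂ 1
  have : IsFiniteMeasure (ENNReal.ofReal lam • kouJumpLaw p l₁ l₂ 1) :=
    Measure.smul_finite _ ENNReal.ofReal_ne_top
  rw [withDensity_kouDensity hlam hp hp1]
  refine ⟨γ - ∫ x in Set.Icc (-1) 1, x ∂(ENNReal.ofReal lam • kouJumpLaw p l₁ l₂ 1), fun u => ?_⟩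
  have hchar : charFun (kouJumpLaw p l₁ l₂ 1) u = kouJumpMGF p l₁ l₂ (u * Complex.I) := by
    rw [← complexMGF_id_mul_I, complexMGF_kouJumpLaw hp hp1 hl₁ hl₂ (by simpa) (by simpa), pow_one]
  rw [levyExponent_of_isFiniteMeasure, charFun_apply_real, integral_smul_measure,
    ← charFun_apply_real, hchar, measureReal_ennreal_smul_apply, probReal_univ,
    ENNReal.toReal_ofReal hlam, Complex.real_smul]
  push_cast
  ring

theorem exists_map_sub_eq_kouLaw_map_add {Ω : Type*} {m : MeasurableSpace Ω} {P : Measure Ω}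
    [IsFiniteMeasure P] {ℱ : Filtration ℝ≥0 m} {X : ℝ≥0 → Ω → ℝ} {lam p l₁ l₂ : ℝ}
    (hlam : 0 ≤ lam) (hp : 0 ≤ p) (hp1 : p ≤ 1) (hl₁ : 0 < l₁) (hl₂ : 0 < l₂)
    (hX : IsPureJumpLevyWithDensity X ℱ P (kouDensity lam p (1 - p) l₁ l₂)) :
    ∃ c : ℝ, ∀ s h : ℝ≥0, P.map (fun ω => X (s + h) ω - X s ω) =
      (kouLaw lam p l₁ l₂ h).map (· + c * h) := by
  obtain ⟨hlevy, γ, -, -, hchar⟩ := hX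
  obtain ⟨c, hc⟩ := exists_levyExponent_kouDensity_eq γ hlam hp hp1 hl₁ hl₂
  refine ⟨c, fun s h => ?_⟩
  have hlamh : 0 ≤ lam * (h : ℝ) := mul_nonneg hlam h.coe_nonneg
  have := isProbabilityMeasure_kouLaw hlamh hp hp1 hl₁ hl₂
  rw [(hlevy.stationary_increments s h).map_eq]
  refine Measure.ext_of_charFun (funext fun u => ?_)
  rw [hchar, charFun_map_add_const, charFun_kouLaw hlamh hp hp1 hl₁ hl₂, hc, ← Complex.exp_add,
    RCLike.inner_apply, conj_trivial]
  push_cast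
  ring_nf

section CondExp

variable {Ω α β F : Type*} {m' m : MeasurableSpace Ω} {mα : MeasurableSpace α}
  {mβ : MeasurableSpace β} [StandardBorelSpace β] [Nonempty β] [NormedAddCommGroup F]
  [NormedSpace ℝ F] [CompleteSpace F] {P : Measure Ω} [IsProbabilityMeasure P]
  {X : Ω → α} {Y : Ω → β} {f : α × β → F}

lemma condExp_prod_comap_ae_eq_integral_map_of_indepFun (hX : Measurable X) (hY : Measurable Y)
    (hXY : IndepFun X Y P) (hf : StronglyMeasurable f)
    (hint : Integrable (fun ω => f (X ω, Y ω)) P) :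
    P[fun ω => f (X ω, Y ω) | mα.comap X] =ᵐ[P] fun ω => ∫ y, f (X ω, y) ∂(P.map Y) := by
  have hcond : condDistrib Y X P =ᵐ[P.map X] Kernel.const α (P.map Y) := by
    have := Measure.isProbabilityMeasure_map (μ := P) hY.aemeasurable
    refine condDistrib_ae_eq_of_measure_eq_compProd X hY.aemeasurable ?_
    rw [Measure.compProd_const]
    exact (indepFun_iff_map_prod_eq_prod_map_map hX.aemeasurable hY.aemeasurable).mp hXY
  filter_upwards [condExp_prod_ae_eq_integral_condDistrib hX hY.aemeasurable hf hint,
    ae_of_ae_map hX.aemeasurable hcond] with ω hω hcondω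
  rw [hω, hcondω, Kernel.const_apply]

lemma condExp_prod_ae_eq_integral_map_of_indep (hm : m' ≤ m)
    (hX : Measurable[m'] X) (hY : Measurable Y) (hind : Indep (mβ.comap Y) m' P)
    (hf : StronglyMeasurable f) (hint : Integrable (fun ω => f (X ω, Y ω)) P) :
    P[fun ω => f (X ω, Y ω) | m'] =ᵐ[P] fun ω => ∫ y, f (X ω, y) ∂(P.map Y) := by
  have hid : @IndepFun Ω Ω β m m' mβ id Y P := by
    rw [@IndepFun_iff_Indep _ _ _ m m', MeasurableSpace.comap_id]
    exact hind.symm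
  have hf' : StronglyMeasurable[m'.prod mβ] fun w : Ω × β => f (X w.1, w.2) :=
    hf.comp_measurable ((hX.comp measurable_fst).prodMk measurable_snd)
  simpa only [MeasurableSpace.comap_id, id_eq] using
    @condExp_prod_comap_ae_eq_integral_map_of_indepFun Ω Ω β F m m' mβ _ _ _ _ _ P _ id Y _
      (measurable_id'' hm) hY hid hf' hint

end CondExp

section Martingale

variable {Ω : Type*} {m : MeasurableSpace Ω} {P : Measure Ω} [IsProbabilityMeasure P]

lemma integral_exp_log_sub_log_eq_one_of_martingale {ι : Type*} [Preorder ι] {ℱ : Filtration ι m}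
    {S : ι → Ω → ℝ} (hpos : ∀ t ω, 0 < S t ω) (hS : Martingale S ℱ P) {s t : ι} (hst : s ≤ t)
    (hind : Indep (MeasurableSpace.comap (fun ω => Real.log (S t ω) - Real.log (S s ω))
      inferInstance) (ℱ s) P) :
    ∫ ω, Real.exp (Real.log (S t ω) - Real.log (S s ω)) ∂P = 1 := by
  have hmeas : ∀ u, Measurable (S u) := fun u => (hS.1 u).measurable.mono (ℱ.le u) le_rfl
  have hindep : IndepFun (S s) (fun ω => Real.exp (Real.log (S t ω) - Real.log (S s ω))) P := by
    have := indep_of_indep_of_le_left hind.symm (hS.1 s).measurable.comap_le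
    exact ((IndepFun_iff_Indep ..).mpr this).comp measurable_id Real.measurable_exp
  have hmean : ∫ ω, S t ω ∂P = ∫ ω, S s ω ∂P := by
    rw [← integral_condExp (ℱ.le s), integral_congr_ae (hS.2 s t hst)]
  have hmean_pos : 0 < ∫ ω, S s ω ∂P :=
    (integral_pos_iff_support_of_nonneg (fun ω => (hpos s ω).le) (hS.integrable s)).mpr <| by
      simp [show (S s).support = Set.univ from Set.eq_univ_of_forall fun ω => (hpos s ω).ne']
  have hprod : ∫ ω, S t ω ∂P =
      (∫ ω, S s ω ∂P) * ∫ ω, Real.exp (Real.log (S t ω) - Real.log (S s ω)) ∂P := by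
    rw [← hindep.integral_fun_mul_eq_mul_integral (hmeas s).aestronglyMeasurable
      ((hmeas t).log.sub (hmeas s).log).exp.aestronglyMeasurable]
    refine integral_congr_ae (ae_of_all _ fun ω => ?_)
    simp only [Real.exp_sub, Real.exp_log (hpos _ _), mul_div_cancel₀ _ (hpos s ω).ne']
  exact mul_left_cancel₀ hmean_pos.ne' (by rw [← hprod, hmean, mul_one])

lemma eq_of_integral_exp_map_kouLaw_eq_one {lam p l₁ l₂ T d : ℝ} (hT : 0 ≤ lam * T) (hp : 0 ≤ p)
    (hp1 : p ≤ 1) (hl₁ : 1 < l₁) (hl₂ : 0 < l₂)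
    (h : ∫ x, Real.exp x ∂(kouLaw lam p l₁ l₂ T).map (· + d) = 1) :
    d = -lam * kouZeta p (1 - p) l₁ l₂ * T := by
  have hmgf := mgf_kouLaw_one hT hp hp1 hl₁ hl₂
  simp only [mgf, one_mul, id] at hmgf
  rw [integral_map (by fun_prop) Real.continuous_exp.aestronglyMeasurable] at h
  simp_rw [Real.exp_add] at h
  rw [integral_mul_const, hmgf, ← Real.exp_add, Real.exp_eq_one_iff] at h
  linarith

lemma callPrice_ae_eq_integral_map {ℱ : Filtration ℝ≥0 m} {S : ℝ≥0 → Ω → ℝ} {K : ℝ} {t T : ℝ≥0}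
    (hpos : ∀ t ω, 0 < S t ω) (hS : ∀ u, Measurable[ℱ u] (S u))
    (hind : Indep (MeasurableSpace.comap (fun ω => Real.log (S T ω) - Real.log (S t ω))
      inferInstance) (ℱ t) P)
    (hint : Integrable (fun ω => max (S T ω - K) 0) P) :
    callPrice S ℱ P K T t =ᵐ[P] fun ω => ∫ x, max (S t ω * Real.exp x - K) 0
      ∂P.map (fun ω => Real.log (S T ω) - Real.log (S t ω)) := by
  have hmul : S T = fun ω => S t ω * Real.exp (Real.log (S T ω) - Real.log (S t ω)) := by
    ext ω
    rw [Real.exp_sub, Real.exp_log (hpos T ω), Real.exp_log (hpos t ω),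
      mul_div_cancel₀ _ (hpos t ω).ne']
  have hmeas : Measurable fun ω => Real.log (S T ω) - Real.log (S t ω) :=
    ((hS T).mono (ℱ.le T) le_rfl).log.sub ((hS t).mono (ℱ.le t) le_rfl).log
  have hpayoff : Measurable fun w : ℝ × ℝ => max (w.1 * Real.exp w.2 - K) 0 := by fun_prop
  have := condExp_prod_ae_eq_integral_map_of_indep (ℱ.le t) (hS t) hmeas hind
    hpayoff.stronglyMeasurable (hint.congr (ae_of_all _ fun ω => by simp only [← congrFun hmul]))
  simpa only [callPrice, ← congrFun hmul] using this

theorem IsKouModel.map_log_sub_log {ℱ : Filtration ℝ≥0 m} {S : ℝ≥0 → Ω → ℝ} {lam p l₁ l₂ : ℝ}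
    (hS : IsKouModel S ℱ P lam p (1 - p) l₁ l₂) (hlam : 0 ≤ lam) (hp : 0 ≤ p) (hp1 : p ≤ 1)
    (hl₁ : 1 < l₁) (hl₂ : 0 < l₂) {t T : ℝ≥0} (htT : t ≤ T) :
    P.map (fun ω => Real.log (S T ω) - Real.log (S t ω)) =
      (kouLaw lam p l₁ l₂ (T - t)).map
        (· + -lam * kouZeta p (1 - p) l₁ l₂ * ((T : ℝ) - t)) := by
  obtain ⟨c, hc⟩ := exists_map_sub_eq_kouLaw_map_add hlam hp hp1 (one_pos.trans hl₁) hl₂ hS.log_levy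
  have hlaw := hc t (T - t)
  rw [add_tsub_cancel_of_le htT, NNReal.coe_sub htT] at hlaw
  have hmeas : Measurable fun ω => Real.log (S T ω) - Real.log (S t ω) :=
    ((hS.martingale.1 T).measurable.mono (ℱ.le T) le_rfl).log.sub
      ((hS.martingale.1 t).measurable.mono (ℱ.le t) le_rfl).log
  have hmean := integral_exp_log_sub_log_eq_one_of_martingale hS.pos hS.martingale htT
    (hS.log_levy.1.indep_increments t T htT)
  rw [← integral_map hmeas.aemeasurable Real.continuous_exp.aestronglyMeasurable, hlaw] at hmean
  have hτ : 0 ≤ (T : ℝ) - t := sub_nonneg.mpr htT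
  rw [hlaw, eq_of_integral_exp_map_kouLaw_eq_one (mul_nonneg hlam hτ) hp hp1 hl₁ hl₂ hmean]

end Martingale

theorem mainTheorem2 {Ω : Type*} {m : MeasurableSpace Ω} (P : Measure Ω) [IsProbabilityMeasure P]
    (ℱ : Filtration ℝ≥0 m) (S : ℝ≥0 → Ω → ℝ) (lam p q l₁ l₂ : ℝ)
    (hlam : 0 ≤ lam) (hp : 0 ≤ p) (hq : 0 ≤ q) (hpq : p + q = 1) (hl₁ : 1 < l₁) (hl₂ : 0 < l₂)
    (hS : IsKouModel S ℱ P lam p q l₁ l₂)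
    (K : ℝ) (hK : 0 < K) (t T : ℝ≥0) (htT : t ≤ T) :
    -- the payoff is integrable and the series defining `Ψ` converge
    Integrable (fun ω => max (S T ω - K) 0) P ∧
    (∀ a : ℝ,
      KouPsiConverges (-lam * kouZeta p q l₁ l₂) (kouLamStar lam p q l₁ l₂) (kouPStar p q l₁ l₂)
        (l₁ - 1) (l₂ + 1) a ((T : ℝ) - t) ∧
      KouPsiConverges (-lam * kouZeta p q l₁ l₂) lam p l₁ l₂ a ((T : ℝ) - t)) ∧
    -- the pricing formula
    callPrice S ℱ P K T t =ᵐ[P] fun ω =>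
      S t ω * kouPsi (-lam * kouZeta p q l₁ l₂) (kouLamStar lam p q l₁ l₂) (kouPStar p q l₁ l₂)
          (l₁ - 1) (l₂ + 1) (Real.log (K / S t ω)) ((T : ℝ) - t) -
        K * kouPsi (-lam * kouZeta p q l₁ l₂) lam p l₁ l₂ (Real.log (K / S t ω)) ((T : ℝ) - t) := by
  obtain rfl : q = 1 - p := by linarith
  have hp1 : p ≤ 1 := sub_nonneg.mp hq
  have hτ : 0 ≤ (T : ℝ) - t := sub_nonneg.mpr htT
  have hlamτ : 0 ≤ lam * ((T : ℝ) - t) := mul_nonneg hlam hτ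
  have hpay : Integrable (fun ω => max (S T ω - K) 0) P :=
    ((hS.martingale.integrable T).sub (integrable_const K)).pos_part
  refine ⟨hpay, fun a => ⟨kouPsiConverges _ a (kouLamStar_mul_nonneg hlamτ hp hp1 hl₁ hl₂)
    (kouPStar_nonneg hp hp1 hl₁ hl₂) (kouPStar_le_one hp hp1 hl₁ hl₂) (sub_pos.mpr hl₁)
    (add_pos hl₂ one_pos), kouPsiConverges _ a hlamτ hp hp1 (one_pos.trans hl₁) hl₂⟩, ?_⟩
  have hprice := callPrice_ae_eq_integral_map hS.pos (fun u => (hS.martingale.1 u).measurable)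
    (hS.log_levy.1.indep_increments t T htT) hpay
  rw [hS.map_log_sub_log hlam hp hp1 hl₁ hl₂ htT] at hprice
  filter_upwards [hprice] with ω hω
  rw [hω, integral_map (by fun_prop) (by fun_prop),
    integral_call_payoff_kouLaw hlamτ hp hp1 hl₁ hl₂ (hS.pos t ω) hK]
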